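/- Let $\mathbb{H}=\{z\in\mathbb{C}:\operatorname{Im} z>0\}$ and let $f:\mathbb{H}\to\mathbb{H}$ be holomorphic without fixed points in $\mathbb{H}$, with iterates $f^n$ ($f^0=\mathrm{Id}$, $f^{n}=f^{n-1}\circ f$). Suppose that * $f$ has Denjoy–Wolff point $\infty$, i.e. $f^n\to\infty$ locally uniformly on $\mathbb{H}$; * $f$ is parabolic, i.e. its angular derivative $f'(\infty)=\angle\lim_{z\to\infty} f(z)/z$ equals $1$ (the limit being taken as $|z|\to\infty$ inside each sector $\{|\operatorname{Re} z|\le M\operatorname{Im} z\}$); * $f$ has positive hyperbolic step, i.e. $\lim_{n\to\infty} d_{\mathbb{H}}(f^{n+1}(z),f^n(z))>0$ for some $z\in\mathbb{H}$, where $d_{\mathbb{H}}(z,w)=\frac12\log\frac{1+\rho(z,w)}{1-\rho(z,w)}$ with $\rho(z,w)=\left|\frac{z-w}{z-\overline{w}}\right|$ is the hyperbolic distance. Then, for every $z\in\mathbb{H}$, the limit $$L(z):=\lim_{n\to\infty}\frac{f^n(z)}{n}$$ exists in the Riemann sphere $\mathbb{C}\cup\{\infty\}$ and belongs to $(\mathbb{R}\setminus\{0\})\cup\{\infty\}$,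 and $L(z)$ does not depend on $z$. Moreover, the following are equivalent: $f$ is of finite shift, i.e. $\lim_{n\to\infty}\operatorname{Im} f^n(z)$ exists and is finite for some $z\in\mathbb{H}$; $L(z)\in\mathbb{R}\setminus\{0\}$ for some $z\in\mathbb{H}$; $L(z)\in\mathbb{R}\setminus\{0\}$ for all $z\in\mathbb{H}$. -/

import Mathlib

open scoped UpperHalfPlane Topology Manifold OnePoint
open Filter

namespace HalfPlane

/-- The pseudo-hyperbolic distance `|z - w| / |z - conj w|` of the upper half-plane. -/
noncomputable def pseudoDist (z w : ℍ) : ℝ :=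
  ‖((z : ℂ) - (w : ℂ)) / ((z : ℂ) - (starRingEnd ℂ) (w : ℂ))‖

/-- The hyperbolic distance of the upper half-plane, normalised to have curvature `-4`. -/
noncomputable def hypDist (z w : ℍ) : ℝ :=
  1 / 2 * Real.log ((1 + pseudoDist z w) / (1 - pseudoDist z w))

/-- The hyperbolic distance above is one half of Mathlib's distance on `ℍ`, which is normalised
to have curvature `-1`. -/
theorem hypDist_eq (z w : ℍ) : hypDist z w = dist z w / 2 := by
  have h : pseudoDist z w = Real.tanh (dist z w / 2) := by
    rw [UpperHalfPlane.tanh_half_dist, pseudoDist, norm_div, Complex.dist_eq, Complex.dist_eq]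
  rw [hypDist, h, Real.tanh_eq_sinh_div_cosh, Real.sinh_eq, Real.cosh_eq]
  set t := dist z w / 2
  have h1 := Real.exp_pos t
  have h2 := Real.exp_pos (-t)
  have h3 : (1 + (Real.exp t - Real.exp (-t)) / 2 / ((Real.exp t + Real.exp (-t)) / 2)) /
      (1 - (Real.exp t - Real.exp (-t)) / 2 / ((Real.exp t + Real.exp (-t)) / 2)) =
      Real.exp t / Real.exp (-t) := by
    have h4 : Real.exp t + Real.exp (-t) ≠ 0 := by positivity
    have h5 : 1 - (Real.exp t - Real.exp (-t)) / 2 / ((Real.exp t + Real.exp (-t)) / 2) =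
        2 * Real.exp (-t) / (Real.exp t + Real.exp (-t)) := by
      field_simp
      ring
    have h6 : 1 + (Real.exp t - Real.exp (-t)) / 2 / ((Real.exp t + Real.exp (-t)) / 2) =
        2 * Real.exp t / (Real.exp t + Real.exp (-t)) := by
      field_simp
      ring
    rw [h5, h6]
    field_simp
  rw [h3, ← Real.exp_sub, Real.log_exp]
  ring

/-- `f` has no fixed point in the upper half-plane. -/
def NonElliptic (f : ℍ → ℍ) : Prop := ∀ z : ℍ, f z ≠ z

/-- The Denjoy–Wolff point of `f` is `∞`: the iterates of `f` converge to `∞` locally uniformly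
on the upper half-plane. -/
def DenjoyWolffInfty (f : ℍ → ℍ) : Prop :=
  ∀ z : ℍ, ∀ R : ℝ, ∃ U ∈ 𝓝 z, ∀ᶠ n : ℕ in atTop, ∀ w ∈ U, R < ‖(f^[n] w : ℂ)‖

/-- `g` has angular (non-tangential) limit `l` at `∞`: for every `M`, `g z → l` as `|z| → ∞`
inside the sector `|Re z| ≤ M * Im z`. -/
def HasAngularLimitAtInfty (g : ℍ → ℂ) (l : ℂ) : Prop :=
  ∀ M : ℝ, Tendsto g
    (comap (fun z : ℍ ↦ (z : ℂ)) (Bornology.cobounded ℂ) ⊓ 𝓟 {z : ℍ | |z.re| ≤ M * z.im}) (𝓝 l)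

/-- `f` is a parabolic holomorphic self-map of the upper half-plane with Denjoy–Wolff point `∞`:
it is non-elliptic, its iterates tend to `∞`, and its angular derivative
`f'(∞) = ∠lim f(z) / z` is `1`. -/
structure IsParabolic (f : ℍ → ℍ) : Prop where
  holomorphic : MDifferentiable 𝓘(ℂ) 𝓘(ℂ) f
  nonElliptic : NonElliptic f
  denjoyWolff : DenjoyWolffInfty f
  angularDeriv : HasAngularLimitAtInfty (fun z : ℍ ↦ (f z : ℂ) / (z : ℂ)) 1

/-- `f` has positive hyperbolic step: for some `z`, the hyperbolic distance between consecutive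
points of the orbit of `z` has a positive limit. -/
def PositiveHyperbolicStep (f : ℍ → ℍ) : Prop :=
  ∃ z : ℍ, ∃ d : ℝ, 0 < d ∧
    Tendsto (fun n : ℕ ↦ hypDist (f^[n + 1] z) (f^[n] z)) atTop (𝓝 d)

/-- `f` is of finite shift: for some `z`, the sequence `Im (f^n z)` has a finite limit. -/
def FiniteShift (f : ℍ → ℍ) : Prop :=
  ∃ z : ℍ, ∃ y : ℝ, Tendsto (fun n : ℕ ↦ (f^[n] z).im) atTop (𝓝 y)

/-- The set `ℝ \ {0}`, as a subset of the Riemann sphere `ℂ ∪ {∞}`. -/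
def nonzeroReals : Set (OnePoint ℂ) := {p | ∃ c : ℝ, c ≠ 0 ∧ p = ((c : ℂ) : OnePoint ℂ)}

end HalfPlane

namespace HalfPlane

/-! Along an orbit `z_n`, write `z_(n+1) - z_n = Im z_n * q_n`. The core claim is that `q_n` tends
to a real `b ≠ 0`. Heights increase by Julia's lemma (`IsParabolic.im_le`), so they converge to some
`y > 0` or to infinity. Cesàro averaging then gives speed `y * b` in the first case and infinite
speed in the second. Schwarz–Pick keeps any two orbits at bounded hyperbolic distance, which makes
the answer independent of the starting point.

To find `b`: positive hyperbolic step forces the ratio of consecutive Blaschke quotients to have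
modulus tending to 1. Since `f` does not lower heights, the rigidity estimate
`exists_blaschke_eq_mul` makes this ratio itself tend to 1, so `q_n` varies slowly. The logarithms
of the height ratios are then slowly varying and non-negative, with sublinear block sums because the
divergence rate is zero; hence they vanish (`tendsto_zero_of_sum_le`) and `Im q_n` tends to 0. The
positive step gives `|q_n|` a positive limit, and slow variation prevents `Re q_n` from changing
sign. -/

/-! ### Blaschke factors and the Schwarz–Pick lemma -/

/-- The open upper half-plane as a subset of `ℂ`. -/
def upper : Set ℂ := {z | 0 < z.im}

theorem isOpen_upper : IsOpen upper := isOpen_lt continuous_const Complex.continuous_im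

/-- The Blaschke factor of the upper half-plane with zero at `z`. -/
noncomputable def blaschke (w z : ℂ) : ℂ := (w - z) / (w - (starRingEnd ℂ) z)

theorem sub_conj_ne_zero {w z : ℂ} (hw : 0 < w.im) (hz : 0 < z.im) :
    w - (starRingEnd ℂ) z ≠ 0 := by
  intro h
  have := congrArg Complex.im h
  simp at this
  linarith

theorem norm_blaschke_lt_one {w z : ℂ} (hw : 0 < w.im) (hz : 0 < z.im) : ‖blaschke w z‖ < 1 := by
  have h0 := sub_conj_ne_zero hw hz
  rw [blaschke, norm_div, div_lt_one (norm_pos_iff.2 h0)]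
  refine lt_of_pow_lt_pow_left₀ 2 (norm_nonneg _) ?_
  rw [← Complex.normSq_eq_norm_sq, ← Complex.normSq_eq_norm_sq, Complex.normSq_apply,
    Complex.normSq_apply]
  simp
  nlinarith [mul_pos hw hz]

/-- The inverse of the Blaschke factor `w ↦ blaschke w z`. -/
noncomputable def blaschkeInv (z k : ℂ) : ℂ := (z - (starRingEnd ℂ) z * k) / (1 - k)

theorem one_sub_blaschke {w z : ℂ} (hw : 0 < w.im) (hz : 0 < z.im) :
    1 - blaschke w z = (z - (starRingEnd ℂ) z) / (w - (starRingEnd ℂ) z) := by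
  have := sub_conj_ne_zero hw hz
  rw [blaschke]
  field_simp
  ring

theorem one_sub_blaschke_ne_zero {w z : ℂ} (hw : 0 < w.im) (hz : 0 < z.im) :
    1 - blaschke w z ≠ 0 := by
  rw [one_sub_blaschke hw hz]
  exact div_ne_zero (sub_conj_ne_zero hz hz) (sub_conj_ne_zero hw hz)

theorem blaschkeInv_blaschke {w z : ℂ} (hw : 0 < w.im) (hz : 0 < z.im) :
    blaschkeInv z (blaschke w z) = w := by
  have h1 := sub_conj_ne_zero hw hz
  have h2 := sub_conj_ne_zero hz hz
  rw [blaschkeInv, one_sub_blaschke hw hz, blaschke]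
  field_simp
  ring

/-- The factor `1 / ‖1 - k‖ ^ 2` lets a lower bound on height force `k` close to 1 in the rigidity
estimate. -/
theorem im_blaschkeInv {z k : ℂ} (hk : 1 - k ≠ 0) :
    (blaschkeInv z k).im = z.im * (1 - ‖k‖ ^ 2) / ‖1 - k‖ ^ 2 := by
  have h : Complex.normSq (1 - k) ≠ 0 := by simpa using hk
  rw [← Complex.normSq_eq_norm_sq, ← Complex.normSq_eq_norm_sq, blaschkeInv, Complex.div_im,
    ← sub_div]
  congr 1
  simp [Complex.normSq_apply]
  ring

theorem one_sub_ne_zero_of_norm_lt {k : ℂ} (hk : ‖k‖ < 1) : 1 - k ≠ 0 := by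
  intro h
  rw [← sub_eq_zero.1 h] at hk
  simp at hk

theorem im_blaschkeInv_pos {z k : ℂ} (hz : 0 < z.im) (hk : ‖k‖ < 1) :
    0 < (blaschkeInv z k).im := by
  have h := one_sub_ne_zero_of_norm_lt hk
  rw [im_blaschkeInv h]
  have : 0 < 1 - ‖k‖ ^ 2 := by nlinarith [norm_nonneg k]
  have := norm_pos_iff.2 h
  positivity

theorem differentiableOn_blaschke {z : ℂ} (hz : 0 < z.im) :
    DifferentiableOn ℂ (fun w ↦ blaschke w z) upper := by
  unfold blaschke
  refine DifferentiableOn.div (by fun_prop) (by fun_prop) fun w hw ↦ sub_conj_ne_zero hw hz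

/-- The Schwarz–Pick lemma for the upper half-plane. -/
theorem norm_blaschke_map_le {F : ℂ → ℂ} (hF : DifferentiableOn ℂ F upper)
    (hmaps : ∀ z ∈ upper, F z ∈ upper) {z w : ℂ} (hz : z ∈ upper) (hw : w ∈ upper) :
    ‖blaschke (F w) (F z)‖ ≤ ‖blaschke w z‖ := by
  have hin : Set.MapsTo (blaschkeInv z) (Metric.ball 0 1) upper := fun k hk ↦
    im_blaschkeInv_pos hz (by simpa using hk)
  have hd : DifferentiableOn ℂ (blaschkeInv z) (Metric.ball 0 1) := by
    unfold blaschkeInv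
    exact DifferentiableOn.div (by fun_prop) (by fun_prop)
      fun k hk ↦ one_sub_ne_zero_of_norm_lt (by simpa using hk)
  have hcomp : DifferentiableOn ℂ (fun k ↦ blaschke (F (blaschkeInv z k)) (F z))
      (Metric.ball 0 1) :=
    (differentiableOn_blaschke (hmaps z hz)).comp (hF.comp hd hin) fun k hk ↦ hmaps _ (hin hk)
  -- In the disc coordinate `k`, the point `z` sits at 0, so the composite fixes 0 and the Schwarz
  -- lemma applies.
  have h := Complex.norm_le_norm_of_mapsTo_ball hcomp (z := blaschke w z)
    (fun k hk ↦ by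
      simpa using (norm_blaschke_lt_one (hmaps _ (hin hk)) (hmaps z hz)).le)
    (by simp [blaschkeInv, blaschke]) (norm_blaschke_lt_one hw hz)
  simpa only [blaschkeInv_blaschke hw hz] using h

theorem norm_blaschke_coe (z w : ℍ) : ‖blaschke z w‖ = Real.tanh (dist z w / 2) := by
  rw [UpperHalfPlane.tanh_half_dist, blaschke, norm_div, Complex.dist_eq, Complex.dist_eq]

theorem dist_le_of_norm_blaschke_le {a b z w : ℍ} (h : ‖blaschke a b‖ ≤ ‖blaschke z w‖) :
    dist a b ≤ dist z w := by
  rw [norm_blaschke_coe, norm_blaschke_coe, Real.tanh_eq_sinh_div_cosh,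
    Real.tanh_eq_sinh_div_cosh, div_le_div_iff₀ (Real.cosh_pos _) (Real.cosh_pos _)] at h
  by_contra! hlt
  have h1 : 0 < Real.sinh (dist a b / 2 - dist z w / 2) := Real.sinh_pos_iff.2 (by linarith)
  rw [Real.sinh_sub] at h1
  linarith

/-- Holomorphic self-maps of the upper half-plane do not increase the hyperbolic distance. -/
theorem dist_map_le {f : ℍ → ℍ} (hf : MDifferentiable 𝓘(ℂ) 𝓘(ℂ) f) (z w : ℍ) :
    dist (f z) (f w) ≤ dist z w := by
  have h1 : DifferentiableOn ℂ (fun z ↦ (f (UpperHalfPlane.ofComplex z) : ℂ)) upper :=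
    UpperHalfPlane.mdifferentiable_iff.1 (UpperHalfPlane.mdifferentiable_coe.comp hf)
  apply dist_le_of_norm_blaschke_le
  simpa using norm_blaschke_map_le h1 (fun z _ ↦ (f _).im_pos) w.im_pos z.im_pos

theorem dist_iterate_le {f : ℍ → ℍ} (hf : MDifferentiable 𝓘(ℂ) 𝓘(ℂ) f) (n : ℕ) (z w : ℍ) :
    dist (f^[n] z) (f^[n] w) ≤ dist z w := by
  induction n with
  | zero => rfl
  | succ n ih =>
    rw [Function.iterate_succ_apply', Function.iterate_succ_apply']
    exact (dist_map_le hf _ _).trans ih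

/-! ### Harnack-type oscillation bounds -/

/-- A holomorphic function with non-negative imaginary part varies little near points where its
imaginary part is small. -/
theorem norm_sub_le_of_im_nonneg {G : ℂ → ℂ} (hG : DifferentiableOn ℂ G upper)
    (him : ∀ z ∈ upper, 0 ≤ (G z).im) (z w : ℍ) :
    ‖G w - G z‖ ≤ (Real.exp (dist w z) - 1) * (G z).im := by
  -- `G` may take real values; the shift by `ε * I` puts it in the open half-plane, where
  -- Schwarz–Pick applies.
  have key : ∀ ε : ℝ, 0 < ε → ‖G w - G z‖ ≤ (Real.exp (dist w z) - 1) * ((G z).im + ε) := by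
    intro ε hε
    have hpos : ∀ z ∈ upper, 0 < (G z + ε * Complex.I).im := fun z hz ↦ by
      have := him z hz
      simp
      linarith
    have hle := norm_blaschke_map_le (F := fun z ↦ G z + ε * Complex.I)
      (hG.add_const _) hpos z.im_pos w.im_pos
    have h1 := UpperHalfPlane.dist_coe_le ⟨_, hpos w w.im_pos⟩ ⟨_, hpos z z.im_pos⟩
    have h2 := dist_le_of_norm_blaschke_le (a := ⟨_, hpos w w.im_pos⟩)
      (b := ⟨_, hpos z z.im_pos⟩) hle
    have h3 := Real.exp_le_exp.2 h2
    have h4 : dist (G w + ε * Complex.I) (G z + ε * Complex.I) = ‖G w - G z‖ := by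
      rw [Complex.dist_eq]
      congr 1
      ring
    have h5 : (G z + ε * Complex.I).im = (G z).im + ε := by simp
    change dist (G w + ε * Complex.I) (G z + ε * Complex.I) ≤
      (G z + ε * Complex.I).im * _ at h1
    rw [h4, h5] at h1
    have h6 := him z z.im_pos
    nlinarith
  have hlim : Tendsto (fun ε : ℝ ↦ (Real.exp (dist w z) - 1) * ((G z).im + ε)) (𝓝[>] 0)
      (𝓝 ((Real.exp (dist w z) - 1) * ((G z).im + 0))) :=
    (Continuous.tendsto (by fun_prop) 0).mono_left nhdsWithin_le_nhds
  rw [add_zero] at hlim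
  exact ge_of_tendsto hlim (eventually_nhdsWithin_of_forall fun ε hε ↦ key ε hε)

/-- A holomorphic function bounded by one varies little near points where its modulus is close
to one. -/
theorem norm_sub_le_of_norm_le_one {h : ℂ → ℂ} (hh : DifferentiableOn ℂ h upper)
    (hle : ∀ z ∈ upper, ‖h z‖ ≤ 1) (z w : ℍ) :
    ‖h w - h z‖ ≤ (Real.exp (dist w z) - 1) * (1 - ‖h z‖) := by
  -- After this rotation, `I * (1 - u * h)` has non-negative imaginary part, equal at `z` to exactly
  -- `1 - ‖h z‖`.
  obtain ⟨u, hu, huz⟩ : ∃ u : ℂ, ‖u‖ = 1 ∧ u * h z = ‖h z‖ := by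
    by_cases h0 : h z = 0
    · exact ⟨1, by simp, by simp [h0]⟩
    · have hn : (‖h z‖ : ℂ) ≠ 0 := by simpa using h0
      refine ⟨‖h z‖ / h z, by simp [h0], by field_simp⟩
  have := norm_sub_le_of_im_nonneg (G := fun z ↦ Complex.I * (1 - u * h z))
    ((hh.const_mul u).const_sub 1 |>.const_mul Complex.I) (fun z hz ↦ by
      have h1 : (u * h z).re ≤ 1 :=
        (Complex.re_le_norm _).trans (by rw [norm_mul, hu, one_mul]; exact hle z hz)
      simp only [Complex.mul_im, Complex.I_re, Complex.I_im, Complex.sub_re, Complex.one_re]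
      linarith) z w
  have e1 : ‖Complex.I * (1 - u * h w) - Complex.I * (1 - u * h z)‖ = ‖h w - h z‖ := by
    rw [show Complex.I * (1 - u * h w) - Complex.I * (1 - u * h z) =
      -Complex.I * u * (h w - h z) by ring, norm_mul, norm_mul, hu]
    simp
  have e2 : (Complex.I * (1 - u * h z)).im = 1 - ‖h z‖ := by
    rw [huz]
    simp
  rwa [e1, e2] at this

/-! ### Consequences of angular derivative 1: Julia's lemma and zero divergence rate -/

/-- The point `i * exp t` of the imaginary axis. -/
noncomputable def imAxis (t : ℝ) : ℍ := ⟨Real.exp t * Complex.I, by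
  rw [Complex.im_ofReal_mul, Complex.I_im, mul_one]
  exact Real.exp_pos t⟩

theorem coe_imAxis (t : ℝ) : (imAxis t : ℂ) = Real.exp t * Complex.I := rfl

theorem re_imAxis (t : ℝ) : (imAxis t).re = 0 := by
  rw [← UpperHalfPlane.coe_re, coe_imAxis]
  simp

theorem im_imAxis (t : ℝ) : (imAxis t).im = Real.exp t := by
  rw [← UpperHalfPlane.coe_im, coe_imAxis, Complex.im_ofReal_mul, Complex.I_im, mul_one]

theorem norm_imAxis (t : ℝ) : ‖(imAxis t : ℂ)‖ = Real.exp t := by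
  rw [coe_imAxis]
  simp

theorem HasAngularLimitAtInfty.tendsto_imAxis {g : ℍ → ℂ} {l : ℂ}
    (h : HasAngularLimitAtInfty g l) : Tendsto (fun t ↦ g (imAxis t)) atTop (𝓝 l) := by
  refine (h 0).comp (tendsto_inf.2 ⟨tendsto_comap_iff.2 ?_, tendsto_principal.2 ?_⟩)
  · rw [← tendsto_norm_atTop_iff_cobounded]
    simpa [Function.comp_def, norm_imAxis] using Real.tendsto_exp_atTop
  · exact Eventually.of_forall fun t ↦ by simp [re_imAxis]

theorem im_map_imAxis (f : ℍ → ℍ) (t : ℝ) :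
    (f (imAxis t)).im = Real.exp t * ((f (imAxis t) : ℂ) / (imAxis t : ℂ)).re := by
  have h : (f (imAxis t) : ℂ) = (f (imAxis t) : ℂ) / (imAxis t : ℂ) * (Real.exp t * Complex.I) := by
    rw [← coe_imAxis, div_mul_cancel₀ _ (UpperHalfPlane.ne_zero _)]
  rw [← UpperHalfPlane.coe_im]
  conv_lhs => rw [h]
  simp only [Complex.mul_im, Complex.mul_re, Complex.ofReal_re, Complex.ofReal_im, Complex.I_re,
    Complex.I_im]
  ring

theorem dist_coe_map_imAxis (f : ℍ → ℍ) (a : ℂ) (t : ℝ) :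
    dist a (f (imAxis t) : ℂ) =
      Real.exp t * ‖a / (imAxis t : ℂ) - (f (imAxis t) : ℂ) / (imAxis t : ℂ)‖ := by
  rw [← sub_div, norm_div, norm_imAxis, mul_div_cancel₀ _ (Real.exp_pos t).ne', Complex.dist_eq]

theorem tendsto_div_imAxis (a : ℂ) : Tendsto (fun t ↦ a / (imAxis t : ℂ)) atTop (𝓝 0) := by
  rw [tendsto_zero_iff_norm_tendsto_zero]
  simp_rw [norm_div, norm_imAxis]
  exact Real.tendsto_exp_atTop.const_div_atTop _

/-- Julia's lemma for maps with angular derivative `1` at `∞`. -/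
theorem IsParabolic.im_le {f : ℍ → ℍ} (hf : IsParabolic f) (z : ℍ) : z.im ≤ (f z).im := by
  have hr := hf.angularDeriv.tendsto_imAxis
  have hre := (Complex.continuous_re.tendsto _).comp hr
  have hpos : ∀ t, 0 < ((f (imAxis t) : ℂ) / (imAxis t : ℂ)).re := fun t ↦ by
    have := (f (imAxis t)).im_pos
    rw [im_map_imAxis] at this
    exact pos_of_mul_pos_right this (Real.exp_pos t).le
  -- Schwarz–Pick in `cosh` form for `z` and `imAxis t`, divided by `exp t / 2`. As `t → ∞` both
  -- numerators tend to 1, leaving the reciprocals of the two heights.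
  have key : ∀ t, ‖(f z : ℂ) / (imAxis t : ℂ) - (f (imAxis t) : ℂ) / (imAxis t : ℂ)‖ ^ 2 /
      ((f z).im * ((f (imAxis t) : ℂ) / (imAxis t : ℂ)).re) ≤
      ‖(z : ℂ) / (imAxis t : ℂ) - 1‖ ^ 2 / z.im := by
    intro t
    have h := Real.cosh_le_cosh.2
      (abs_le_abs_of_nonneg dist_nonneg (dist_map_le hf.holomorphic z (imAxis t)))
    have h2 := dist_coe_map_imAxis id z t
    simp only [id, div_self (UpperHalfPlane.ne_zero _)] at h2
    rw [UpperHalfPlane.cosh_dist, UpperHalfPlane.cosh_dist, dist_coe_map_imAxis, h2, im_imAxis,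
      im_map_imAxis] at h
    have hz := z.im_pos
    have hfz := (f z).im_pos
    have := hpos t
    have he := Real.exp_pos t
    generalize ((f (imAxis t) : ℂ) / (imAxis t : ℂ)).re = r at *
    generalize ‖(f z : ℂ) / (imAxis t : ℂ) - (f (imAxis t) : ℂ) / (imAxis t : ℂ)‖ = A at *
    generalize ‖(z : ℂ) / (imAxis t : ℂ) - 1‖ = B at *
    generalize Real.exp t = e at *
    have e1 : (e * A) ^ 2 / (2 * (f z).im * (e * r)) = e / 2 * (A ^ 2 / ((f z).im * r)) := by
      field_simp
    have e2 : (e * B) ^ 2 / (2 * z.im * e) = e / 2 * (B ^ 2 / z.im) := by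
      field_simp
    rw [e1, e2] at h
    exact le_of_mul_le_mul_left (by linarith) (half_pos he)
  have hl : Tendsto (fun t ↦
      ‖(f z : ℂ) / (imAxis t : ℂ) - (f (imAxis t) : ℂ) / (imAxis t : ℂ)‖ ^ 2 /
      ((f z).im * ((f (imAxis t) : ℂ) / (imAxis t : ℂ)).re)) atTop
      (𝓝 (‖(0 : ℂ) - 1‖ ^ 2 / ((f z).im * (1 : ℂ).re))) :=
    (((tendsto_div_imAxis _).sub hr).norm.pow 2).div (hre.const_mul _)
      (by simpa using (f z).im_pos.ne')
  have hrt : Tendsto (fun t ↦ ‖(z : ℂ) / (imAxis t : ℂ) - 1‖ ^ 2 / z.im) atTop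
      (𝓝 (‖(0 : ℂ) - 1‖ ^ 2 / z.im)) :=
    (((tendsto_div_imAxis _).sub_const 1).norm.pow 2).div_const _
  have := le_of_tendsto_of_tendsto' hl hrt key
  simp only [zero_sub, norm_neg, norm_one, one_pow, Complex.one_re, mul_one] at this
  exact (one_div_le_one_div (f z).im_pos z.im_pos).1 this

/-- A parabolic map moves some points by an arbitrarily small hyperbolic distance. -/
theorem IsParabolic.exists_dist_lt {f : ℍ → ℍ} (hf : IsParabolic f) {ε : ℝ} (hε : 0 < ε) :
    ∃ w, dist w (f w) < ε := by
  have hr := hf.angularDeriv.tendsto_imAxis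
  have hre := (Complex.continuous_re.tendsto _).comp hr
  have hle : ∀ t, dist (imAxis t) (f (imAxis t)) ≤
      ‖1 - (f (imAxis t) : ℂ) / (imAxis t : ℂ)‖ / √((f (imAxis t) : ℂ) / (imAxis t : ℂ)).re := by
    intro t
    refine (UpperHalfPlane.dist_le_dist_coe_div_sqrt _ _).trans (le_of_eq ?_)
    rw [dist_coe_map_imAxis, im_imAxis, im_map_imAxis, ← mul_assoc, Real.sqrt_mul (by positivity),
      Real.sqrt_mul_self (Real.exp_pos t).le, div_self (UpperHalfPlane.ne_zero _),
      mul_div_mul_left _ _ (Real.exp_pos t).ne']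
  have hlim : Tendsto (fun t ↦ ‖1 - (f (imAxis t) : ℂ) / (imAxis t : ℂ)‖ /
      √((f (imAxis t) : ℂ) / (imAxis t : ℂ)).re) atTop (𝓝 (‖(1 : ℂ) - 1‖ / √(1 : ℂ).re)) :=
    (hr.const_sub 1).norm.div ((Real.continuous_sqrt.tendsto _).comp hre) (by simp)
  rw [sub_self, norm_zero, zero_div] at hlim
  obtain ⟨t, ht⟩ := (hlim.eventually_lt_const hε).exists
  exact ⟨_, (hle t).trans_lt ht⟩

/-- The orbits of a parabolic map have vanishing divergence rate, uniformly along the orbit. -/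
theorem IsParabolic.exists_dist_iterate_le {f : ℍ → ℍ} (hf : IsParabolic f) (z : ℍ) {ε : ℝ}
    (hε : 0 < ε) : ∃ D, ∀ n m : ℕ, dist (f^[n + m] z) (f^[n] z) ≤ D + m * ε := by
  obtain ⟨w, hw⟩ := hf.exists_dist_lt hε
  have hwm : ∀ m : ℕ, dist (f^[m] w) w ≤ m * ε := by
    intro m
    induction m with
    | zero => simp
    | succ m ih =>
      rw [Function.iterate_succ_apply]
      have h1 := dist_triangle (f^[m] (f w)) (f^[m] w) w
      have h2 := dist_iterate_le hf.holomorphic m (f w) w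
      rw [dist_comm (f w)] at h2
      push_cast
      linarith
  -- One `dist z w` for passing from `f^[m] z` to `f^[m] w`, one for returning from `w` to `z`;
  -- applying `f^[n]` only shrinks distances.
  refine ⟨2 * dist z w, fun n m ↦ ?_⟩
  rw [Function.iterate_add_apply]
  have h1 := dist_iterate_le hf.holomorphic n (f^[m] z) z
  have h2 := dist_triangle4 (f^[m] z) (f^[m] w) w z
  have h3 := dist_iterate_le hf.holomorphic m z w
  have h4 := hwm m
  rw [dist_comm w z] at h2
  linarith

/-- A slowly varying non-negative sequence whose block sums grow sublinearly tends to zero. -/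
theorem tendsto_zero_of_sum_le {l : ℕ → ℝ} (h0 : ∀ n, 0 ≤ l n)
    (hslow : Tendsto (fun n ↦ l (n + 1) - l n) atTop (𝓝 0))
    (hsum : ∀ ε : ℝ, 0 < ε → ∃ D : ℝ, ∀ n m : ℕ,
      ∑ j ∈ Finset.range m, l (n + j) ≤ D + m * ε) :
    Tendsto l atTop (𝓝 0) := by
  rw [Metric.tendsto_atTop]
  intro η hη
  obtain ⟨D, hD⟩ := hsum (η / 4) (by positivity)
  -- If `l n ≥ η`, slow variation keeps `l` above `η / 2` for `m` steps; this `m` makes `m * η / 2`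
  -- exceed `D + m * η / 4`.
  obtain ⟨m, hm⟩ := exists_nat_gt (max 1 (4 * D / η))
  have hm1 : (1 : ℝ) < m := (le_max_left _ _).trans_lt hm
  have hm2 : 4 * D < m * η := (div_lt_iff₀ hη).1 ((le_max_right _ _).trans_lt hm)
  obtain ⟨N, hN⟩ := Metric.tendsto_atTop.1 hslow (η / (2 * m)) (by positivity)
  refine ⟨N, fun n hn ↦ ?_⟩
  rw [Real.dist_eq, sub_zero, abs_of_nonneg (h0 n)]
  by_contra! hlarge
  have hstep : ∀ j : ℕ, η - j * (η / (2 * m)) ≤ l (n + j) := by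
    intro j
    induction j with
    | zero => simpa using hlarge
    | succ j ih =>
      have := hN (n + j) (by omega)
      rw [Real.dist_eq, sub_zero] at this
      have := (abs_lt.1 this).1
      rw [← add_assoc]
      push_cast
      linarith
  have hlow : ∑ j ∈ Finset.range m, η / 2 ≤ ∑ j ∈ Finset.range m, l (n + j) := by
    refine Finset.sum_le_sum fun j hj ↦ le_trans ?_ (hstep j)
    have hjm : (j : ℝ) ≤ m := by exact_mod_cast (Finset.mem_range.1 hj).le
    have : (j : ℝ) * (η / (2 * m)) ≤ m * (η / (2 * m)) := by gcongr
    have e : (m : ℝ) * (η / (2 * m)) = η / 2 := by field_simp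
    linarith
  rw [Finset.sum_const, Finset.card_range, nsmul_eq_mul] at hlow
  linarith [hD n m]

/-! ### Rigidity in Schwarz–Pick -/

/-- Quantitative rigidity in the Schwarz–Pick lemma: if `f` does not decrease imaginary parts and
nearly preserves the hyperbolic distance of `z` and `f z`, then it is nearly affine on that pair. -/
theorem exists_blaschke_eq_mul {f : ℍ → ℍ} (hf : MDifferentiable 𝓘(ℂ) 𝓘(ℂ) f)
    (him : ∀ z, z.im ≤ (f z).im) (z : ℍ) :
    ∃ u : ℂ, blaschke (f (f z)) (f z) = u * blaschke (f z) z ∧ ‖u‖ ≤ 1 ∧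
      ∀ T : ℝ, 1 < T → ‖1 - u‖ ≤ √(Real.exp (dist (f z) z) / T) + 2 / (T + 1) +
        T * Real.exp (dist (f z) z) * (1 - ‖u‖) := by
  set F : ℂ → ℂ := fun w ↦ (f (UpperHalfPlane.ofComplex w) : ℂ) with hFdef
  have hFd : DifferentiableOn ℂ F upper :=
    UpperHalfPlane.mdifferentiable_iff.1 (UpperHalfPlane.mdifferentiable_coe.comp hf)
  have hFmaps : ∀ w ∈ upper, F w ∈ upper := fun w _ ↦ (f _).im_pos
  have hFc : ∀ w : ℍ, F w = f w := fun w ↦ by simp [F]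
  have hΦ : DifferentiableOn ℂ (fun w ↦ blaschke (F w) (F z)) upper :=
    (differentiableOn_blaschke (hFmaps _ z.im_pos)).comp hFd hFmaps
  -- The quotient of the Blaschke factors after and before applying `f`, with its singularity at `z`
  -- removed by `dslope`. The required `u` is `h (f z)`.
  set h : ℂ → ℂ := fun w ↦ dslope (fun w ↦ blaschke (F w) (F z)) z w *
    (w - (starRingEnd ℂ) (z : ℂ)) with hh
  have hd : DifferentiableOn ℂ h upper :=
    ((Complex.differentiableOn_dslope (isOpen_upper.mem_nhds z.im_pos)).2 hΦ).mul
      (by fun_prop)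
  have hmul : ∀ w ∈ upper, blaschke (F w) (F z) = h w * blaschke w z := by
    intro w hw
    have h1 := sub_conj_ne_zero hw z.im_pos
    have h2 := sub_smul_dslope (fun w ↦ blaschke (F w) (F z)) z w
    have h3 : blaschke (F z) (F z) = 0 := by simp [blaschke]
    rw [h3, sub_zero, smul_eq_mul] at h2
    rw [← h2, hh, blaschke]
    field_simp
  have hle' : ∀ w ∈ upper, w ≠ z → ‖h w‖ ≤ 1 := by
    intro w hw hne
    have h1 := norm_blaschke_map_le hFd hFmaps z.im_pos hw
    have h2 : 0 < ‖blaschke w z‖ := norm_pos_iff.2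
      (div_ne_zero (sub_ne_zero.2 hne) (sub_conj_ne_zero hw z.im_pos))
    rw [hmul w hw, norm_mul] at h1
    exact le_of_mul_le_mul_right (by linarith) h2
  have hle : ∀ w ∈ upper, ‖h w‖ ≤ 1 := by
    intro w hw
    by_cases hwz : w = z
    · have hc : ContinuousAt h w := (hd.differentiableAt (isOpen_upper.mem_nhds hw)).continuousAt
      have hlim : Tendsto (fun w ↦ ‖h w‖) (𝓝[≠] w) (𝓝 ‖h w‖) := hc.norm.tendsto.mono_left
        nhdsWithin_le_nhds
      refine le_of_tendsto hlim ?_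
      filter_upwards [self_mem_nhdsWithin, nhdsWithin_le_nhds (isOpen_upper.mem_nhds hw)] with
        v hv1 hv2
      exact hle' v hv2 (by rw [← hwz]; exact hv1)
    · exact hle' w hw hwz
  refine ⟨h (f z), ?_, hle _ (f z).im_pos, fun T hT ↦ ?_⟩
  · have := hmul (f z) (f z).im_pos
    rwa [hFc, hFc] at this
  have hy := z.im_pos
  have hT0 : 0 < T := by linarith
  -- A test point high above `z`: its Blaschke factor is real and close to 1 for large `T`, and its
  -- image must also be high.
  set w : ℍ := ⟨⟨z.re, T * z.im⟩, by positivity⟩ with hw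
  have hwre : w.re = z.re := rfl
  have hwim : w.im = T * z.im := rfl
  have hdist : dist w z = Real.log T := by
    rw [UpperHalfPlane.dist_of_re_eq hwre, hwim, Real.log_mul hT0.ne' hy.ne', Real.dist_eq,
      add_sub_cancel_right, abs_of_nonneg (Real.log_nonneg hT.le)]
  have hexp : Real.exp (dist w (f z)) ≤ T * Real.exp (dist (f z) z) := by
    have := dist_triangle w z (f z)
    rw [hdist, dist_comm z] at this
    calc _ ≤ Real.exp (Real.log T + dist (f z) z) := Real.exp_le_exp.2 this
      _ = _ := by rw [Real.exp_add, Real.exp_log hT0]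
  have hb : blaschke w z = ((T - 1) / (T + 1) : ℝ) := by
    have e1 : (w : ℂ) - z = ((T - 1) * z.im : ℝ) * Complex.I := by
      apply Complex.ext <;> (simp [hwre, hwim]; try ring)
    have e2 : (w : ℂ) - (starRingEnd ℂ) (z : ℂ) = ((T + 1) * z.im : ℝ) * Complex.I := by
      apply Complex.ext <;> (simp [hwre, hwim]; try ring)
    rw [blaschke, e1, e2, mul_div_mul_right _ _ Complex.I_ne_zero, ← Complex.ofReal_div,
      mul_div_mul_right _ _ hy.ne']
  set k : ℂ := h w * ((T - 1) / (T + 1) : ℝ) with hk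
  have hkeq : blaschke (f w) (f z) = k := by
    have := hmul w w.im_pos
    rwa [hFc, hFc, hb] at this
  have hk1 : 1 - k ≠ 0 := by
    rw [← hkeq]
    exact one_sub_blaschke_ne_zero (f w).im_pos (f z).im_pos
  -- The height of `f w` is at least `T * z.im` but at most `(f z).im / ‖1 - k‖ ^ 2`, while `(f
  -- z).im` is at most `z.im * exp (dist (f z) z)`.
  have hsq : ‖1 - k‖ ^ 2 ≤ Real.exp (dist (f z) z) / T := by
    have h1 : (f w).im = (f z).im * (1 - ‖k‖ ^ 2) / ‖1 - k‖ ^ 2 := by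
      rw [← UpperHalfPlane.coe_im, ← blaschkeInv_blaschke (f w).im_pos (f z).im_pos, hkeq,
        im_blaschkeInv hk1]
      rfl
    have h2 := him w
    have h3 := UpperHalfPlane.im_le_im_mul_exp_dist (f z) z
    have h4 := norm_pos_iff.2 hk1
    rw [h1, hwim, le_div_iff₀ (by positivity)] at h2
    rw [le_div_iff₀ hT0]
    have h5 : (f z).im * (1 - ‖k‖ ^ 2) ≤ (f z).im :=
      mul_le_of_le_one_right (f z).im_pos.le (by linarith [sq_nonneg ‖k‖])
    refine le_of_mul_le_mul_left ?_ hy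
    nlinarith
  have h1 : ‖1 - k‖ ≤ √(Real.exp (dist (f z) z) / T) := Real.le_sqrt_of_sq_le hsq
  have h2 : ‖k - h w‖ ≤ 2 / (T + 1) := by
    have : k - h w = h w * ((-(2 / (T + 1)) : ℝ) : ℂ) := by
      rw [hk, ← mul_sub_one, ← Complex.ofReal_one, ← Complex.ofReal_sub]
      congr 2
      field_simp
      ring
    rw [this, norm_mul, Complex.norm_real, Real.norm_eq_abs, abs_neg,
      abs_of_pos (by positivity)]
    exact mul_le_of_le_one_left (by positivity) (hle w w.im_pos)
  have h3 : ‖h w - h (f z)‖ ≤ T * Real.exp (dist (f z) z) * (1 - ‖h (f z)‖) := by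
    refine (norm_sub_le_of_norm_le_one hd hle (f z) w).trans ?_
    refine mul_le_mul_of_nonneg_right (by linarith) ?_
    linarith [hle _ (f z).im_pos]
  calc ‖1 - h (f z)‖ = ‖(1 - k) + (k - h w) + (h w - h (f z))‖ := by congr 1; ring
    _ ≤ _ := (norm_add₃_le).trans (by linarith)

/-- The consecutive Blaschke quotients along an orbit of positive hyperbolic step vary slowly. -/
theorem IsParabolic.tendsto_blaschke_sub {f : ℍ → ℍ} (hf : IsParabolic f) {z : ℍ} {d : ℝ}
    (hd : 0 < d) (hz : Tendsto (fun n ↦ dist (f^[n + 1] z) (f^[n] z)) atTop (𝓝 d)) :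
    Tendsto (fun n ↦ blaschke (f^[n + 2] z) (f^[n + 1] z) - blaschke (f^[n + 1] z) (f^[n] z))
      atTop (𝓝 0) := by
  have hex := fun n ↦ exists_blaschke_eq_mul hf.holomorphic hf.im_le (f^[n] z)
  simp only [← Function.iterate_succ_apply' f] at hex
  choose u hmul hu1 hu using hex
  have htanh : Continuous Real.tanh := by
    rw [show Real.tanh = fun x ↦ Real.sinh x / Real.cosh x from
      funext Real.tanh_eq_sinh_div_cosh]
    exact Real.continuous_sinh.div Real.continuous_cosh fun x ↦ (Real.cosh_pos x).ne'
  have hρ : Tendsto (fun n ↦ ‖blaschke (f^[n + 1] z) (f^[n] z)‖) atTop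
      (𝓝 (Real.tanh (d / 2))) := by
    simp_rw [norm_blaschke_coe]
    exact (htanh.tendsto _).comp (hz.div_const 2)
  have hρ0 : Real.tanh (d / 2) ≠ 0 := by
    rw [Real.tanh_eq_sinh_div_cosh]
    exact (div_pos (Real.sinh_pos_iff.2 (by positivity)) (Real.cosh_pos _)).ne'
  -- Positive step enters here: consecutive moduli share a non-zero limit, so their quotient tends
  -- to 1.
  have hnu : Tendsto (fun n ↦ ‖u n‖) atTop (𝓝 1) := by
    have h1 := (hρ.comp (tendsto_add_atTop_nat 1)).div hρ hρ0
    rw [div_self hρ0] at h1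
    refine h1.congr' ?_
    filter_upwards [hρ.eventually_ne hρ0] with n hn
    simp only [Function.comp_apply, Pi.div_apply]
    rw [hmul n, norm_mul, mul_div_cancel_right₀ _ hn]
  set E := Real.exp (dist (f z) z)
  have hE : ∀ n, Real.exp (dist (f^[n + 1] z) (f^[n] z)) ≤ E := fun n ↦ by
    rw [Function.iterate_succ_apply]
    exact Real.exp_le_exp.2 (dist_iterate_le hf.holomorphic n _ _)
  have hut : Tendsto (fun n ↦ 1 - u n) atTop (𝓝 0) := by
    rw [Metric.tendsto_atTop']
    intro ε hε
    -- The bound `E` is uniform in `n`, so `T` can be fixed before `n` is taken large.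
    have hT : Tendsto (fun T : ℝ ↦ √(E / T) + 2 / (T + 1)) atTop (𝓝 (√0 + 0)) :=
      ((Real.continuous_sqrt.tendsto _).comp (tendsto_id.const_div_atTop E)).add
        ((tendsto_atTop_add_const_right _ 1 tendsto_id).const_div_atTop 2)
    rw [Real.sqrt_zero, add_zero] at hT
    obtain ⟨T, hT1, hT2⟩ :=
      ((hT.eventually_lt_const (half_pos hε)).and (eventually_gt_atTop 1)).exists
    have hN : Tendsto (fun n ↦ T * E * (1 - ‖u n‖)) atTop (𝓝 (T * E * (1 - 1))) :=
      (hnu.const_sub 1).const_mul _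
    rw [sub_self, mul_zero] at hN
    obtain ⟨N, hN⟩ := eventually_atTop.1 (hN.eventually_lt_const (half_pos hε))
    refine ⟨N, fun n hn ↦ ?_⟩
    rw [dist_zero_right]
    have h1 := hu n T hT2
    have h2 : √(Real.exp (dist (f^[n + 1] z) (f^[n] z)) / T) ≤ √(E / T) := by
      have := hE n
      gcongr
    have h3 : T * Real.exp (dist (f^[n + 1] z) (f^[n] z)) * (1 - ‖u n‖) ≤
        T * E * (1 - ‖u n‖) := by
      have := hE n
      have := sub_nonneg.2 (hu1 n)
      gcongr
    linarith [hN n hn.le]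
  rw [tendsto_zero_iff_norm_tendsto_zero] at hut ⊢
  refine squeeze_zero (fun n ↦ norm_nonneg _) (fun n ↦ ?_) hut
  rw [hmul n, ← sub_one_mul, norm_mul, norm_sub_rev]
  exact mul_le_of_le_one_right (norm_nonneg _)
    (norm_blaschke_lt_one (UpperHalfPlane.im_pos _) (UpperHalfPlane.im_pos _)).le

/-! ### Rescaled increments along an orbit -/

/-- The increment from `z` to `w`, rescaled by the height of `z`. -/
noncomputable def relStep (w z : ℍ) : ℂ := ((w : ℂ) - z) / (z.im : ℂ)

theorem im_ne_zero_complex (z : ℍ) : (z.im : ℂ) ≠ 0 := by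
  exact_mod_cast z.im_pos.ne'

theorem relStep_eq (w z : ℍ) :
    relStep w z = 2 * Complex.I * blaschke w z / (1 - blaschke w z) := by
  have h1 := sub_conj_ne_zero w.im_pos z.im_pos
  have h2 := im_ne_zero_complex z
  have h3 : (z : ℂ) - (starRingEnd ℂ) (z : ℂ) = 2 * Complex.I * z.im := by
    rw [Complex.sub_conj, UpperHalfPlane.coe_im]
    push_cast
    ring
  rw [one_sub_blaschke w.im_pos z.im_pos, h3, blaschke, relStep]
  field_simp

theorem im_relStep (w z : ℍ) : (relStep w z).im = w.im / z.im - 1 := by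
  rw [relStep, Complex.div_ofReal_im, Complex.sub_im, UpperHalfPlane.coe_im,
    UpperHalfPlane.coe_im, sub_div, div_self z.im_pos.ne']

theorem norm_relStep_sq (w z : ℍ) :
    ‖relStep w z‖ ^ 2 = 2 * (w.im / z.im) * (Real.cosh (dist w z) - 1) := by
  have := z.im_pos
  have := w.im_pos
  rw [UpperHalfPlane.cosh_dist, relStep, norm_div, Complex.dist_eq, Complex.norm_real,
    Real.norm_eq_abs, abs_of_pos z.im_pos]
  field_simp
  ring

/-- The Blaschke quotients stay in a disc of radius `r < 1`, on which the Möbius map `k ↦ 2ik / (1 -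
k)` is Lipschitz, so slow variation carries over. -/
theorem IsParabolic.tendsto_relStep_sub {f : ℍ → ℍ} (hf : IsParabolic f) {z : ℍ} {d : ℝ}
    (hd : 0 < d) (hz : Tendsto (fun n ↦ dist (f^[n + 1] z) (f^[n] z)) atTop (𝓝 d)) :
    Tendsto (fun n ↦ relStep (f^[n + 2] z) (f^[n + 1] z) - relStep (f^[n + 1] z) (f^[n] z))
      atTop (𝓝 0) := by
  have h := hf.tendsto_blaschke_sub hd hz
  set r := ‖blaschke (f z) z‖
  have hr1 : r < 1 := norm_blaschke_lt_one (f z).im_pos z.im_pos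
  have hr : ∀ n, ‖blaschke (f^[n + 1] z) (f^[n] z)‖ ≤ r := by
    intro n
    induction n with
    | zero => exact le_rfl
    | succ n ih =>
      have hF : DifferentiableOn ℂ (fun z ↦ (f (UpperHalfPlane.ofComplex z) : ℂ)) upper :=
        UpperHalfPlane.mdifferentiable_iff.1
          (UpperHalfPlane.mdifferentiable_coe.comp hf.holomorphic)
      have := norm_blaschke_map_le hF (fun z _ ↦ (f _).im_pos) (f^[n] z).im_pos
        (f^[n + 1] z).im_pos
      simp only [UpperHalfPlane.ofComplex_apply, ← Function.iterate_succ_apply' f] at this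
      exact this.trans ih
  have hlow : ∀ n, 1 - r ≤ ‖1 - blaschke (f^[n + 1] z) (f^[n] z)‖ := fun n ↦ by
    have := norm_sub_norm_le (1 : ℂ) (blaschke (f^[n + 1] z) (f^[n] z))
    rw [norm_one] at this
    linarith [hr n]
  have hlim := (h.norm.const_mul 2).div_const ((1 - r) * (1 - r))
  rw [norm_zero, mul_zero, zero_div] at hlim
  refine squeeze_zero_norm (fun n ↦ ?_) hlim
  have n1 := one_sub_blaschke_ne_zero (f^[n + 1] z).im_pos (f^[n] z).im_pos
  have n2 := one_sub_blaschke_ne_zero (f^[n + 2] z).im_pos (f^[n + 1] z).im_pos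
  have h1 := hlow n
  have h2 := hlow (n + 1)
  rw [relStep_eq, relStep_eq]
  generalize blaschke (f^[n + 1] z) (f^[n] z) = a at *
  change 1 - r ≤ ‖1 - blaschke (f^[n + 2] z) (f^[n + 1] z)‖ at h2
  generalize blaschke (f^[n + 2] z) (f^[n + 1] z) = b at *
  have e : 2 * Complex.I * b / (1 - b) - 2 * Complex.I * a / (1 - a) =
      2 * Complex.I * (b - a) / ((1 - b) * (1 - a)) := by
    field_simp
    ring
  have hr0 : 0 < 1 - r := by linarith
  rw [e, norm_div, norm_mul, norm_mul, norm_mul, Complex.norm_I, mul_one, Complex.norm_ofNat]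
  gcongr

theorem abs_log_sub_log_le {a b : ℝ} (ha : 1 ≤ a) (hb : 1 ≤ b) :
    |Real.log a - Real.log b| ≤ |a - b| := by
  have key : ∀ {a b : ℝ}, 1 ≤ a → 1 ≤ b → Real.log a - Real.log b ≤ |a - b| := by
    intro a b ha hb
    have hb0 : 0 < b := by linarith
    rw [← Real.log_div (by linarith) hb0.ne']
    refine (Real.log_le_sub_one_of_pos (by positivity)).trans ?_
    rw [div_sub_one hb0.ne']
    refine (le_abs_self _).trans ?_
    rw [abs_div]
    exact div_le_self (abs_nonneg _) (hb.trans (le_abs_self b))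
  refine abs_le.2 ⟨?_, key ha hb⟩
  have := key hb ha
  rw [abs_sub_comm] at this
  linarith

theorem IsParabolic.one_le_im_div {f : ℍ → ℍ} (hf : IsParabolic f) (z : ℍ) (n : ℕ) :
    1 ≤ (f^[n + 1] z).im / (f^[n] z).im := by
  rw [one_le_div (UpperHalfPlane.im_pos _), Function.iterate_succ_apply']
  exact hf.im_le _

/-- Along orbits of positive hyperbolic step, the ratio of consecutive heights tends to `1`. -/
theorem IsParabolic.tendsto_im_div {f : ℍ → ℍ} (hf : IsParabolic f) {z : ℍ} {d : ℝ}
    (hd : 0 < d) (hz : Tendsto (fun n ↦ dist (f^[n + 1] z) (f^[n] z)) atTop (𝓝 d)) :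
    Tendsto (fun n ↦ (f^[n + 1] z).im / (f^[n] z).im) atTop (𝓝 1) := by
  have hsub := (Complex.continuous_im.tendsto _).comp (hf.tendsto_relStep_sub hd hz)
  simp only [Function.comp_def, Complex.sub_im, im_relStep, sub_sub_sub_cancel_right,
    Complex.zero_im] at hsub
  have hl : Tendsto (fun n ↦ Real.log ((f^[n + 1] z).im / (f^[n] z).im)) atTop (𝓝 0) := by
    refine tendsto_zero_of_sum_le (fun n ↦ Real.log_nonneg (hf.one_le_im_div z n)) ?_ ?_
    · refine squeeze_zero_norm (fun n ↦ ?_) (by simpa using hsub.abs)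
      exact abs_log_sub_log_le (hf.one_le_im_div z (n + 1)) (hf.one_le_im_div z n)
    · intro ε hε
      obtain ⟨D, hD⟩ := hf.exists_dist_iterate_le z hε
      refine ⟨D, fun n m ↦ ?_⟩
      -- The sum telescopes to a difference of log-heights, which hyperbolic distance dominates.
      have hsum : ∑ j ∈ Finset.range m,
          Real.log ((f^[n + j + 1] z).im / (f^[n + j] z).im) =
          Real.log (f^[n + m] z).im - Real.log (f^[n] z).im := by
        refine Eq.trans ?_ (Finset.sum_range_sub (fun j ↦ Real.log (f^[n + j] z).im) m)
        exact Finset.sum_congr rfl fun j _ ↦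
          Real.log_div (UpperHalfPlane.im_pos _).ne' (UpperHalfPlane.im_pos _).ne'
      rw [hsum]
      refine (le_abs_self _).trans (le_trans ?_ (hD n m))
      exact UpperHalfPlane.dist_log_im_le _ _
  have := (Real.continuous_exp.tendsto _).comp hl
  rw [Real.exp_zero] at this
  refine this.congr fun n ↦ ?_
  exact Real.exp_log (by linarith [hf.one_le_im_div z n])

/-- A slowly varying real sequence whose squares have a positive limit converges. -/
theorem exists_tendsto_of_sq {r : ℕ → ℝ} {c : ℝ} (hc : 0 < c)
    (hsq : Tendsto (fun n ↦ r n ^ 2) atTop (𝓝 c))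
    (hslow : Tendsto (fun n ↦ r (n + 1) - r n) atTop (𝓝 0)) :
    ∃ b : ℝ, b ≠ 0 ∧ Tendsto r atTop (𝓝 b) := by
  have hsc := Real.sqrt_pos.2 hc
  have habs : Tendsto (fun n ↦ |r n|) atTop (𝓝 √c) := by
    simpa only [Function.comp_def, Real.sqrt_sq_eq_abs] using
      (Real.continuous_sqrt.tendsto _).comp hsq
  -- Beyond `N`, terms exceed `√c / 2` in modulus and steps are smaller than that, so the sign is
  -- frozen.
  obtain ⟨N, hN⟩ := eventually_atTop.1 ((habs.eventually_const_lt (half_lt_self hsc)).and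
    (hslow.abs.eventually_lt_const (u := √c / 2) (by rw [abs_zero]; exact half_pos hsc)))
  have hstep : ∀ n ≥ N, (0 < r n → 0 < r (n + 1)) ∧ (r n < 0 → r (n + 1) < 0) := by
    intro n hn
    have h1 := (hN n hn).1
    have h2 := abs_lt.1 (hN n hn).2
    constructor
    · intro h
      rw [abs_of_pos h] at h1
      linarith
    · intro h
      rw [abs_of_neg h] at h1
      linarith
  have hN0 : r N ≠ 0 := fun h ↦ by
    have := (hN N le_rfl).1
    rw [h, abs_zero] at this
    linarith
  rcases lt_or_gt_of_ne hN0 with hneg | hpos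
  · have hall : ∀ n ≥ N, r n < 0 := fun n hn ↦ by
      induction n, hn using Nat.le_induction with
      | base => exact hneg
      | succ n hn ih => exact (hstep n hn).2 ih
    refine ⟨-√c, by simpa using hsc.ne', habs.neg.congr' ?_⟩
    filter_upwards [eventually_ge_atTop N] with n hn
    rw [abs_of_neg (hall n hn), neg_neg]
  · have hall : ∀ n ≥ N, 0 < r n := fun n hn ↦ by
      induction n, hn using Nat.le_induction with
      | base => exact hpos
      | succ n hn ih => exact (hstep n hn).1 ih
    refine ⟨√c, hsc.ne', habs.congr' ?_⟩
    filter_upwards [eventually_ge_atTop N] with n hn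
    rw [abs_of_pos (hall n hn)]

/-- Along orbits of positive hyperbolic step, the rescaled increments converge to a non-zero
real number. -/
theorem IsParabolic.exists_tendsto_relStep {f : ℍ → ℍ} (hf : IsParabolic f) {z : ℍ} {d : ℝ}
    (hd : 0 < d) (hz : Tendsto (fun n ↦ dist (f^[n + 1] z) (f^[n] z)) atTop (𝓝 d)) :
    ∃ b : ℝ, b ≠ 0 ∧ Tendsto (fun n ↦ relStep (f^[n + 1] z) (f^[n] z)) atTop (𝓝 (b : ℂ)) := by
  have ha := hf.tendsto_im_div hd hz
  have him : Tendsto (fun n ↦ (relStep (f^[n + 1] z) (f^[n] z)).im) atTop (𝓝 0) := by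
    simpa only [im_relStep, sub_self] using ha.sub_const 1
  have hnorm : Tendsto (fun n ↦ ‖relStep (f^[n + 1] z) (f^[n] z)‖ ^ 2) atTop
      (𝓝 (2 * 1 * (Real.cosh d - 1))) := by
    simp only [norm_relStep_sq]
    exact (ha.const_mul 2).mul (((Real.continuous_cosh.tendsto d).comp hz).sub_const 1)
  have hc : 0 < 2 * 1 * (Real.cosh d - 1) := by
    have := Real.one_lt_cosh.2 hd.ne'
    linarith
  have hre : Tendsto (fun n ↦ (relStep (f^[n + 1] z) (f^[n] z)).re ^ 2) atTop
      (𝓝 (2 * 1 * (Real.cosh d - 1))) := by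
    have := hnorm.sub (him.pow 2)
    rw [zero_pow two_ne_zero, sub_zero] at this
    refine this.congr fun n ↦ ?_
    rw [← Complex.normSq_eq_norm_sq, Complex.normSq_apply]
    ring
  have hslow := (Complex.continuous_re.tendsto _).comp (hf.tendsto_relStep_sub hd hz)
  obtain ⟨b, hb, hlim⟩ := exists_tendsto_of_sq hc hre (by simpa [Function.comp_def] using hslow)
  refine ⟨b, hb, ?_⟩
  have h1 := ((Complex.continuous_ofReal.tendsto b).comp hlim).add
    (((Complex.continuous_ofReal.tendsto 0).comp him).mul_const Complex.I)
  simpa [Function.comp_def, Complex.re_add_im] using h1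

/-! ### From increments to speed -/

/-- If the increments of a real sequence tend to infinity, so do its averages. -/
theorem tendsto_div_atTop_of_sub {x : ℕ → ℝ}
    (h : Tendsto (fun n ↦ x (n + 1) - x n) atTop atTop) :
    Tendsto (fun n : ℕ ↦ x n / n) atTop atTop := by
  refine tendsto_atTop.2 fun M ↦ ?_
  -- Truncation gives a finite limit for Cesàro. Of the margin 2, one unit is lost in the average
  -- and one to `x 0 / n`.
  have h1 : Tendsto (fun n ↦ min (x (n + 1) - x n) (M + 2)) atTop (𝓝 (M + 2)) :=
    tendsto_const_nhds.congr' <| by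
      filter_upwards [h.eventually_ge_atTop (M + 2)] with n hn
      rw [min_eq_right hn]
  have h2 : Tendsto (fun n : ℕ ↦ x 0 / n) atTop (𝓝 0) :=
    tendsto_natCast_atTop_atTop.const_div_atTop _
  filter_upwards [h1.cesaro.eventually_const_lt (show M + 1 < M + 2 by linarith),
    h2.eventually_const_lt (show (-1 : ℝ) < 0 by norm_num)] with n hn1 hn2
  have h3 : ∑ i ∈ Finset.range n, min (x (i + 1) - x i) (M + 2) ≤ x n - x 0 := by
    rw [← Finset.sum_range_sub]
    exact Finset.sum_le_sum fun i _ ↦ min_le_left _ _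
  have h4 : (n : ℝ)⁻¹ * ∑ i ∈ Finset.range n, min (x (i + 1) - x i) (M + 2) ≤
      (n : ℝ)⁻¹ * (x n - x 0) := by gcongr
  have e : (n : ℝ)⁻¹ * (x n - x 0) = x n / n - x 0 / n := by ring
  linarith

theorem IsParabolic.monotone_im {f : ℍ → ℍ} (hf : IsParabolic f) (z : ℍ) :
    Monotone fun n ↦ (f^[n] z).im :=
  monotone_nat_of_le_succ fun n ↦ by
    rw [Function.iterate_succ_apply']
    exact hf.im_le _

theorem sub_eq_im_mul_relStep (w z : ℍ) : (w : ℂ) - z = z.im * relStep w z := by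
  rw [relStep, mul_div_cancel₀ _ (im_ne_zero_complex z)]

/-- If the heights converge along one orbit with real rescaled increments, then all orbits have
the same real non-zero speed. -/
theorem IsParabolic.tendsto_div_of_tendsto_im {f : ℍ → ℍ} (hf : IsParabolic f) {z : ℍ} {b : ℂ}
    {y : ℝ} (hb : Tendsto (fun n ↦ relStep (f^[n + 1] z) (f^[n] z)) atTop (𝓝 b))
    (hy : Tendsto (fun n ↦ (f^[n] z).im) atTop (𝓝 y)) (w : ℍ) :
    Tendsto (fun n : ℕ ↦ (f^[n] w : ℂ) / (n : ℂ)) atTop (𝓝 (y * b)) := by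
  have h1 : Tendsto (fun n ↦ (f^[n + 1] z : ℂ) - (f^[n] z : ℂ)) atTop (𝓝 (y * b)) := by
    simp only [sub_eq_im_mul_relStep]
    exact ((Complex.continuous_ofReal.tendsto y).comp hy).mul hb
  have h2 := h1.cesaro_smul
  simp only [Finset.sum_range_sub (fun n ↦ (f^[n] z : ℂ))] at h2
  -- Bounded heights turn the bounded hyperbolic gap between orbits into a bounded Euclidean one; `+
  -- z` restores the initial term of the telescoped sum.
  have hw : Tendsto (fun n : ℕ ↦ ((f^[n] w : ℂ) - f^[n] z + z) / (n : ℂ)) atTop (𝓝 0) := by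
    have hlim : Tendsto (fun n : ℕ ↦ (y * (Real.exp (dist w z) - 1) + ‖(z : ℂ)‖) / (n : ℝ))
        atTop (𝓝 0) := tendsto_natCast_atTop_atTop.const_div_atTop _
    refine squeeze_zero_norm (fun n ↦ ?_) hlim
    rw [norm_div, Complex.norm_natCast]
    gcongr
    refine (norm_add_le _ _).trans (add_le_add_left ?_ _)
    have h3 := UpperHalfPlane.dist_coe_le (f^[n] w) (f^[n] z)
    rw [Complex.dist_eq] at h3
    have h4 := Real.exp_le_exp.2 (dist_iterate_le hf.holomorphic n w z)
    have h5 := (hf.monotone_im z).ge_of_tendsto hy n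
    have h6 := Real.one_le_exp (x := dist w z) dist_nonneg
    refine h3.trans ?_
    have h7 := (f^[n] z).im_pos
    have h8 := Real.one_le_exp (x := dist (f^[n] w) (f^[n] z)) dist_nonneg
    exact mul_le_mul h5 (by linarith) (by linarith) (h7.le.trans h5)
  have := h2.add hw
  rw [add_zero] at this
  refine this.congr fun n ↦ ?_
  rw [Complex.real_smul, Complex.ofReal_inv, Complex.ofReal_natCast, inv_mul_eq_div, ← add_div,
    Function.iterate_zero, id]
  congr 1
  ring

/-- Since `w.im ≤ ‖w‖`, a hyperbolic bound becomes a multiplicative one, which transfers infinite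
speed between orbits even when heights are unbounded. -/
theorem norm_coe_le (z w : ℍ) : ‖(z : ℂ)‖ ≤ Real.exp (dist z w) * ‖(w : ℂ)‖ := by
  have h1 := UpperHalfPlane.dist_coe_le z w
  rw [Complex.dist_eq] at h1
  have h2 : w.im ≤ ‖(w : ℂ)‖ := (le_abs_self _).trans (Complex.abs_im_le_norm (w : ℂ))
  have h3 := norm_sub_norm_le (z : ℂ) w
  have h4 := Real.one_le_exp (x := dist z w) dist_nonneg
  nlinarith

/-- If the heights tend to infinity along one orbit with real rescaled increments, then all
orbits have infinite speed. -/
theorem IsParabolic.tendsto_norm_div_of_tendsto_im {f : ℍ → ℍ} (hf : IsParabolic f) {z : ℍ}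
    {b : ℝ} (hb0 : b ≠ 0)
    (hb : Tendsto (fun n ↦ relStep (f^[n + 1] z) (f^[n] z)) atTop (𝓝 (b : ℂ)))
    (hy : Tendsto (fun n ↦ (f^[n] z).im) atTop atTop) (w : ℍ) :
    Tendsto (fun n : ℕ ↦ ‖(f^[n] w : ℂ) / (n : ℂ)‖) atTop atTop := by
  -- Multiplying by `b` makes the drift positive whatever the sign of `b`.
  have h1 : Tendsto (fun n ↦ b * (f^[n + 1] z).re - b * (f^[n] z).re) atTop atTop := by
    have h2 : Tendsto (fun n ↦ b * (relStep (f^[n + 1] z) (f^[n] z)).re) atTop (𝓝 (b * b)) :=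
      ((Complex.continuous_re.tendsto _).comp hb).const_mul b
    refine (hy.atTop_mul_pos (mul_self_pos.2 hb0) h2).congr fun n ↦ ?_
    have h3 := congrArg Complex.re (sub_eq_im_mul_relStep (f^[n + 1] z) (f^[n] z))
    rw [Complex.re_ofReal_mul, Complex.sub_re, UpperHalfPlane.coe_re,
      UpperHalfPlane.coe_re] at h3
    linear_combination -b * h3
  have h2 := tendsto_div_atTop_of_sub (x := fun n ↦ b * (f^[n] z).re) h1
  have hc : 0 < |b| * Real.exp (dist z w) := by positivity
  refine tendsto_atTop_mono (fun n ↦ ?_) (h2.atTop_div_const hc)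
  rw [norm_div, Complex.norm_natCast, div_right_comm]
  gcongr
  rw [div_le_iff₀ hc]
  have h3 := norm_coe_le (f^[n] z) (f^[n] w)
  have h4 := Real.exp_le_exp.2 (dist_iterate_le hf.holomorphic n z w)
  calc b * (f^[n] z).re ≤ |b| * |(f^[n] z).re| := by rw [← abs_mul]; exact le_abs_self _
    _ ≤ |b| * (Real.exp (dist z w) * ‖(f^[n] w : ℂ)‖) := by
      gcongr
      refine (Complex.abs_re_le_norm (f^[n] z : ℂ)).trans (h3.trans ?_)
      gcongr
    _ = _ := by ring

end HalfPlane

/-! ### The dichotomy for the limiting height -/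

theorem proposition3p3 (f : ℍ → ℍ) (hf : HalfPlane.IsParabolic f)
    (hstep : HalfPlane.PositiveHyperbolicStep f) :
    ∃ L : ℍ → OnePoint ℂ,
      (∀ z : ℍ, Tendsto (fun n : ℕ ↦ (((f^[n] z : ℂ) / (n : ℂ) : ℂ) : OnePoint ℂ))
        atTop (𝓝 (L z))) ∧
      (∀ z : ℍ, L z ∈ HalfPlane.nonzeroReals ∪ {∞}) ∧
      (∀ z w : ℍ, L z = L w) ∧
      (HalfPlane.FiniteShift f ↔ ∃ z : ℍ, L z ∈ HalfPlane.nonzeroReals) ∧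
      (HalfPlane.FiniteShift f ↔ ∀ z : ℍ, L z ∈ HalfPlane.nonzeroReals) := by
  obtain ⟨z, d, hd, hz⟩ := hstep
  have hz' : Tendsto (fun n ↦ dist (f^[n + 1] z) (f^[n] z)) atTop (𝓝 (2 * d)) := by
    refine (hz.const_mul 2).congr fun n ↦ ?_
    rw [HalfPlane.hypDist_eq]
    ring
  obtain ⟨b, hb0, hb⟩ := hf.exists_tendsto_relStep (by positivity) hz'
  rcases tendsto_atTop_of_monotone (hf.monotone_im z) with hy | ⟨y, hy⟩
  -- Finite shift may be witnessed by another orbit, but heights on two orbits are comparable up to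
  -- the factor `exp (dist z w)`.
  · have hnot : ¬ HalfPlane.FiniteShift f := by
      rintro ⟨w, c, hc⟩
      refine not_tendsto_atTop_of_tendsto_nhds (hc.mul_const (Real.exp (dist z w)))
        (tendsto_atTop_mono (fun n ↦ ?_) hy)
      refine (UpperHalfPlane.im_le_im_mul_exp_dist _ (f^[n] w)).trans ?_
      have := (f^[n] w).im_pos
      have := HalfPlane.dist_iterate_le hf.holomorphic n z w
      gcongr
    have hmem : (∞ : OnePoint ℂ) ∉ HalfPlane.nonzeroReals := by
      rintro ⟨c, -, hc⟩
      exact OnePoint.infty_ne_coe _ hc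
    refine ⟨fun _ ↦ ∞, fun w ↦ ?_, fun _ ↦ Or.inr rfl, fun _ _ ↦ rfl,
      iff_of_false hnot fun ⟨_, h⟩ ↦ hmem h, iff_of_false hnot fun h ↦ hmem (h z)⟩
    refine OnePoint.tendsto_coe_infty.comp ?_
    rw [coclosedCompact_eq_cocompact, ← Metric.cobounded_eq_cocompact,
      ← tendsto_norm_atTop_iff_cobounded]
    exact hf.tendsto_norm_div_of_tendsto_im hb0 hb hy w
  · have hshift : HalfPlane.FiniteShift f := ⟨z, y, hy⟩
    have hy0 : y ≠ 0 :=
      (z.im_pos.trans_le ((hf.monotone_im z).ge_of_tendsto hy 0)).ne'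
    have hmem : (((y * b : ℝ) : ℂ) : OnePoint ℂ) ∈ HalfPlane.nonzeroReals :=
      ⟨y * b, mul_ne_zero hy0 hb0, rfl⟩
    refine ⟨fun _ ↦ ((y * b : ℝ) : ℂ), fun w ↦ ?_, fun _ ↦ Or.inl hmem, fun _ _ ↦ rfl,
      iff_of_true hshift ⟨z, hmem⟩, iff_of_true hshift fun _ ↦ hmem⟩
    refine (OnePoint.continuous_coe.tendsto _).comp ?_
    rw [Complex.ofReal_mul]
    exact hf.tendsto_div_of_tendsto_im hb hy w
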